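/- Let $(\mathcal M,g)$ be a nonempty compact smooth Riemannian manifold without boundary, with volume measure $\mu_g$ and Laplace–Beltrami operator $\Delta_g=\operatorname{div}_g\nabla$, and let $\upsilon>0$. Let $\tilde f:\mathcal M\to\mathbb R$ be a continuous function (for instance a sanitized data density), put $\tilde f_{\min}=\min_{\mathcal M}\tilde f$, $\tilde f_{\max}=\max_{\mathcal M}\tilde f$, and let $\tilde c=\operatorname{vol}(\mathcal M)^{-1}\int_{\mathcal M}\tilde f\,d\mu_g$ be its average. Let $\sigma\in C^2(\mathcal M)$ solve $$(-\Delta_g+\upsilon)\,\sigma=\tilde c-\tilde f\quad\text{on }\mathcal M,$$ and set $\phi=e^{2\sigma}$. Then for every $x\in\mathcal M$ $$\frac{\tilde c-\tilde f_{\max}}{\upsilon}\le\sigma(x)\le\frac{\tilde c-\tilde f_{\min}}{\upsilon},\qquad \exp\!\Big(\tfrac{2}{\upsilon}(\tilde c-\tilde f_{\max})\Big)\le\phi(x)\le\exp\!\Big(\tfrac{2}{\upsilon}(\tilde c-\tilde f_{\min})\Big).$$ Moreover the bounds are sharp: if $\tilde f$ is constant, then $\sigma\equiv0$ and $\phi\equiv1$,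 and all four inequalities are equalities. -/

import Mathlib

open Set MeasureTheory
open scoped Manifold ContDiff Bundle

noncomputable section

/-- A smooth (`C^∞`) Riemannian metric on a smooth `d`-dimensional manifold without boundary:
a smoothly varying inner product on the tangent spaces. -/
abbrev SmoothMetric (d : ℕ) (M : Type*) [TopologicalSpace M]
    [ChartedSpace (EuclideanSpace ℝ (Fin d)) M] [IsManifold (𝓡 d) ∞ M] :=
  Bundle.ContMDiffRiemannianMetric (𝓡 d) ∞ (EuclideanSpace ℝ (Fin d))
    (fun x : M => TangentSpace (𝓡 d) x)

namespace SmoothMetric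

variable {d : ℕ} {M : Type*} [TopologicalSpace M]
  [ChartedSpace (EuclideanSpace ℝ (Fin d)) M] [IsManifold (𝓡 d) ∞ M]

/-- The partial derivative `∂_i F (y)` of a real function on `ℝ^d`. -/
def partialD (i : Fin d) (F : EuclideanSpace ℝ (Fin d) → ℝ) (y : EuclideanSpace ℝ (Fin d)) : ℝ :=
  fderiv ℝ F y (EuclideanSpace.single i 1)

/-- The coordinate vector field `∂_i = d(φ⁻¹)(e_i)` of the chart `φ`, at the point `φ⁻¹ y`. -/
def coordVec (φ : OpenPartialHomeomorph M (EuclideanSpace ℝ (Fin d))) (i : Fin d)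
    (y : EuclideanSpace ℝ (Fin d)) : TangentSpace (𝓡 d) (φ.symm y) :=
  mfderiv (𝓡 d) (𝓡 d) φ.symm y (EuclideanSpace.single i 1 : EuclideanSpace ℝ (Fin d))

/-- The matrix `g_{ij}(y) = ⟨∂_i, ∂_j⟩` of the metric in the chart `φ`. -/
def gram (g : SmoothMetric d M) (φ : OpenPartialHomeomorph M (EuclideanSpace ℝ (Fin d)))
    (y : EuclideanSpace ℝ (Fin d)) : Matrix (Fin d) (Fin d) ℝ :=
  Matrix.of fun i j => g.inner (φ.symm y) (coordVec φ i y) (coordVec φ j y)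

/-- The volume density `√det (g_{ij})` in the chart `φ`. -/
def volDensity (g : SmoothMetric d M) (φ : OpenPartialHomeomorph M (EuclideanSpace ℝ (Fin d)))
    (y : EuclideanSpace ℝ (Fin d)) : ℝ :=
  Real.sqrt (g.gram φ y).det

/-- The components `(∇u)^i = ∑_j g^{ij} ∂_j (u ∘ φ⁻¹)` of the gradient of `u` in the chart `φ`. -/
def gradCoord (g : SmoothMetric d M) (φ : OpenPartialHomeomorph M (EuclideanSpace ℝ (Fin d)))
    (u : M → ℝ) (i : Fin d) (y : EuclideanSpace ℝ (Fin d)) : ℝ :=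
  ∑ j, (g.gram φ y)⁻¹ i j * partialD j (u ∘ φ.symm) y

/-- The divergence `(1 / √det g) ∑_i ∂_i (√det g · V^i)` in the chart `φ` of the vector field
with components `V^i`. -/
def divCoord (g : SmoothMetric d M) (φ : OpenPartialHomeomorph M (EuclideanSpace ℝ (Fin d)))
    (V : Fin d → EuclideanSpace ℝ (Fin d) → ℝ) (y : EuclideanSpace ℝ (Fin d)) : ℝ :=
  (g.volDensity φ y)⁻¹ * ∑ i, partialD i (fun z => g.volDensity φ z * V i z) y

/-- The Laplace–Beltrami operator `Δ_g u = div_g (∇ u)`, evaluated at `x` in the preferred chart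
at `x` (its value does not depend on the chart). -/
def laplaceBeltrami (g : SmoothMetric d M) (u : M → ℝ) (x : M) : ℝ :=
  let φ := chartAt (EuclideanSpace ℝ (Fin d)) x
  g.divCoord φ (g.gradCoord φ u) (φ x)

section Volume

variable [MeasurableSpace M]

/-- The measure `√det (g_{ij}) dx¹ ⋯ dx^d` of the chart `φ`, carried over to its domain in `M`. -/
def chartVolume (g : SmoothMetric d M)
    (φ : OpenPartialHomeomorph M (EuclideanSpace ℝ (Fin d))) : Measure M :=
  Measure.map φ.symm
    ((volume.restrict φ.target).withDensity fun y => ENNReal.ofReal (g.volDensity φ y))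

/-- The measure glued from the chart measures by means of the partition of unity `ρ`. -/
def partitionVolume (g : SmoothMetric d M) (ρ : SmoothPartitionOfUnity M (𝓡 d) M) : Measure M :=
  Measure.sum fun p : M =>
    (g.chartVolume (chartAt (EuclideanSpace ℝ (Fin d)) p)).withDensity
      fun x => ENNReal.ofReal (ρ p x)

/-- The Riemannian volume measure `μ_g`: the chart measures `√det (g_{ij}) dx¹ ⋯ dx^d`, glued by a
smooth partition of unity subordinate to the cover by chart domains (the measure does not depend
on the partition). -/
def riemannianVolume [T2Space M] [SigmaCompactSpace M] (g : SmoothMetric d M) : Measure M :=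
  g.partitionVolume
    (SmoothPartitionOfUnity.exists_isSubordinate_chartAt_source (𝓡 d) M).choose

end Volume

end SmoothMetric

/-- The conformal factor `φ = e^{2σ}`. -/
def conformalFactor {M : Type*} (σ : M → ℝ) (x : M) : ℝ :=
  Real.exp (2 * σ x)

end

/-! The bounds are the maximum principle for `-Δ + υ`. At a maximum `z` of `σ`, which exists by
compactness, `Δσ(z) ≤ 0`, so `υ σ(z) ≤ c - f(z) ≤ c - fmin`; the lower bound is this applied to
`-σ`, and the bounds on `φ` follow since `exp` is increasing.

The sign of `Δσ(z)` is read off in the chart at `z`, so chart independence of `Δ` is never needed.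
The first derivatives vanish there, leaving `∑ g^{ij} ∂_i∂_j σ`: a positive definite matrix
contracted with a negative semidefinite Hessian.

That `c` is the average matters only for sharpness: a constant has itself as average because the
total volume is finite and nonzero. Then both bounds are zero. -/

open Filter Topology in
/-- The product rule at a zero of the second factor only needs continuity of the first factor. -/
theorem HasFDerivAt.continuousAt_mul_of_eq_zero {E : Type*} [NormedAddCommGroup E]
    [NormedSpace ℝ E] {A B : E → ℝ} {B' : E →L[ℝ] ℝ} {y : E} (hB : HasFDerivAt B B' y)
    (hA : ContinuousAt A y) (h0 : B y = 0) :
    HasFDerivAt (fun z => A z * B z) (A y • B') y := by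
  have h1 : HasFDerivAt (fun z => A y * B z) (A y • B') y := hB.const_mul (A y)
  -- The product is `o(1) · O(z - y)`, hence `o(z - y)`, so differentiability of `A` is not needed.
  have h2 : HasFDerivAt (fun z => (A z - A y) * B z) (0 : E →L[ℝ] ℝ) y := by
    rw [hasFDerivAt_iff_isLittleO]
    have hs : (fun z => A z - A y) =o[𝓝 y] (fun _ => (1 : ℝ)) := by
      rw [Asymptotics.isLittleO_one_iff]
      simpa using Filter.Tendsto.sub_const hA (A y)
    have hb : B =O[𝓝 y] fun z => z - y := by
      simpa [h0] using hB.isBigO_sub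
    have := hs.mul_isBigO hb.norm_right
    simpa [h0] using this.norm_right
  refine ((h1.add h2).congr_fderiv (by simp)).congr_of_eventuallyEq ?_
  filter_upwards with z
  simp only [Pi.add_apply]
  ring

open Filter Topology in
/-- At a local maximum the second derivative is negative semidefinite. -/
theorem IsLocalMax.fderiv_fderiv_nonpos {E : Type*} [NormedAddCommGroup E] [NormedSpace ℝ E]
    {F : E → ℝ} {y : E} (hF : ContDiffAt ℝ 2 F y) (hmax : IsLocalMax F y) (v : E) :
    fderiv ℝ (fderiv ℝ F) y v v ≤ 0 := by
  have hline : HasDerivAt (fun t : ℝ => y + t • v) v 0 := by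
    simpa using ((hasDerivAt_id (0 : ℝ)).smul_const v).const_add y
  have hcont : Tendsto (fun t : ℝ => y + t • v) (𝓝 0) (𝓝 y) := by
    simpa using hline.continuousAt.tendsto
  have hd1 : ∀ᶠ t in 𝓝 (0 : ℝ),
      deriv (fun t : ℝ => F (y + t • v)) t = fderiv ℝ F (y + t • v) v := by
    have hdiff : ∀ᶠ z in 𝓝 y, DifferentiableAt ℝ F z :=
      (hF.eventually (by simp)).mono fun z hz => hz.differentiableAt (by simp)
    filter_upwards [hcont.eventually hdiff] with t ht
    have hl : HasDerivAt (fun t : ℝ => y + t • v) v t := by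
      simpa using ((hasDerivAt_id t).smul_const v).const_add y
    exact (ht.hasFDerivAt.comp_hasDerivAt t hl).deriv
  have hd2 : deriv (deriv fun t : ℝ => F (y + t • v)) 0 = fderiv ℝ (fderiv ℝ F) y v v := by
    rw [Filter.EventuallyEq.deriv_eq hd1]
    have hG : DifferentiableAt ℝ (fderiv ℝ F) y :=
      (hF.fderiv_right (m := 1) (by norm_num)).differentiableAt (by simp)
    have hy : y = y + (0 : ℝ) • v := by simp
    have hGl : HasDerivAt (fun t : ℝ => fderiv ℝ F (y + t • v)) (fderiv ℝ (fderiv ℝ F) y v) 0 :=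
      hG.hasFDerivAt.comp_hasDerivAt_of_eq (0 : ℝ) hline hy
    have hGv := hGl.clm_apply (hasDerivAt_const (0 : ℝ) v)
    rw [hGv.deriv, map_zero, add_zero]
  by_contra! hpos
  have hmax' : IsLocalMax (fun t : ℝ => F (y + t • v)) 0 := by
    have : ∀ᶠ t in 𝓝 (0 : ℝ), F (y + t • v) ≤ F y := hcont.eventually hmax
    simpa [IsLocalMax, IsMaxFilter] using this
  have hcF : ContinuousAt (fun t : ℝ => F (y + t • v)) 0 := by
    refine ContinuousAt.comp (g := F) ?_ hline.continuousAt
    simpa using hF.continuousAt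
  -- A positive second derivative would make `0` a local minimum as well, so `F` would be constant
  -- along the line near `0` and the second derivative would vanish.
  have hmin' := isLocalMin_of_deriv_deriv_pos (hd2 ▸ hpos) hmax'.deriv_eq_zero hcF
  have hconst : (fun t : ℝ => F (y + t • v)) =ᶠ[𝓝 0] fun _ => F (y + (0 : ℝ) • v) := by
    filter_upwards [hmin', hmax'] with t h1 h2 using le_antisymm h2 h1
  have h0 := hconst.deriv.deriv_eq
  rw [hd2] at h0
  simp only [deriv_const', deriv_const] at h0
  exact hpos.ne' h0

open scoped MatrixOrder Matrix.Norms.L2Operator in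
/-- The contraction of a positive semidefinite matrix with a negative semidefinite bilinear form
is nonpositive. -/
theorem Matrix.PosSemidef.sum_mul_apply_nonpos {ι E : Type*} [Fintype ι] [NormedAddCommGroup E]
    [NormedSpace ℝ E] {A : Matrix ι ι ℝ} (hA : A.PosSemidef) (L : E →L[ℝ] E →L[ℝ] ℝ)
    (hL : ∀ v, L v v ≤ 0) (e : ι → E) :
    ∑ i, ∑ j, A i j * L (e i) (e j) ≤ 0 := by
  classical
  -- Factoring `A = BᵀB` turns the contraction into a sum of values `L w w` with `w = ∑ i, B k i • e
  -- i`.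
  obtain ⟨B, rfl⟩ := CStarAlgebra.nonneg_iff_eq_star_mul_self.mp hA.nonneg
  have : ∑ i, ∑ j, (star B * B) i j * L (e i) (e j)
      = ∑ k, L (∑ i, B k i • e i) (∑ i, B k i • e i) := by
    simp only [Matrix.mul_apply, Matrix.star_apply, star_trivial, map_sum, map_smul,
      FunLike.coe_sum, Finset.sum_apply, _root_.smul_apply, smul_eq_mul,
      Finset.sum_mul, Finset.mul_sum]
    rw [Finset.sum_congr rfl fun i _ => Finset.sum_comm, Finset.sum_comm]
    refine Finset.sum_congr rfl fun k _ => ?_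
    rw [Finset.sum_comm]
    exact Finset.sum_congr rfl fun i _ => Finset.sum_congr rfl fun j _ => by ring
  rw [this]
  exact Finset.sum_nonpos fun k _ => hL _

/-! ### The Laplace–Beltrami operator in charts -/

namespace SmoothMetric

variable {d : ℕ} {M : Type*} [TopologicalSpace M]
  [ChartedSpace (EuclideanSpace ℝ (Fin d)) M] [IsManifold (𝓡 d) ∞ M]

/-- The coordinate Laplacian is nonpositive at a local maximum. -/
theorem divCoord_gradCoord_nonpos (g : SmoothMetric d M)
    (φ : OpenPartialHomeomorph M (EuclideanSpace ℝ (Fin d))) (u : M → ℝ)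
    (y : EuclideanSpace ℝ (Fin d)) (hu : ContDiffAt ℝ 2 (u ∘ φ.symm) y)
    (hmax : IsLocalMax (u ∘ φ.symm) y) (hg : ContinuousAt (g.gram φ) y)
    (hpos : (g.gram φ y).PosDef) :
    g.divCoord φ (g.gradCoord φ u) y ≤ 0 := by
  set F := u ∘ φ.symm
  have hdet : (g.gram φ y).det ≠ 0 := hpos.det_pos.ne'
  have hvol : ContinuousAt (g.volDensity φ) y :=
    Real.continuous_sqrt.continuousAt.comp (f := fun z => (g.gram φ z).det)
      (Continuous.matrix_det continuous_id |>.continuousAt.comp hg)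
  have hinv : ContinuousAt (fun z => (g.gram φ z)⁻¹) y := by
    simp only [Matrix.inv_def, Ring.inverse_eq_inv']
    have hd : ContinuousAt (fun z => (g.gram φ z).det) y :=
      Continuous.matrix_det continuous_id |>.continuousAt.comp hg
    have ha : ContinuousAt (fun z => (g.gram φ z).adjugate) y :=
      Continuous.matrix_adjugate continuous_id |>.continuousAt.comp hg
    exact (hd.inv₀ hdet).smul ha
  have hinvij : ∀ i j, ContinuousAt (fun z => (g.gram φ z)⁻¹ i j) y := fun i j =>
    (continuous_id.matrix_elem i j).continuousAt.comp hinv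
  have hG : DifferentiableAt ℝ (fderiv ℝ F) y :=
    (hu.fderiv_right (m := 1) (by norm_num)).differentiableAt (by simp)
  have hD : ∀ j, HasFDerivAt (partialD j F)
      ((fderiv ℝ (fderiv ℝ F) y).flip (EuclideanSpace.single j 1)) y := fun j => by
    have := hG.hasFDerivAt.clm_apply
      (hasFDerivAt_const (EuclideanSpace.single j 1 : EuclideanSpace ℝ (Fin d)) y)
    refine this.congr_fderiv ?_
    ext v
    simp
  have hD0 : ∀ j, partialD j F y = 0 := fun j => by
    simp [partialD, hmax.fderiv_eq_zero]
  -- Every term carries a factor `∂_j F` that vanishes at `y`, so derivatives of the metric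
  -- coefficients drop out.
  have key : ∀ i, partialD i (fun z => g.volDensity φ z * g.gradCoord φ u i z) y
      = g.volDensity φ y * ∑ j, (g.gram φ y)⁻¹ i j *
        fderiv ℝ (fderiv ℝ F) y (EuclideanSpace.single i 1) (EuclideanSpace.single j 1) := by
    intro i
    have h1 : HasFDerivAt (fun z => g.volDensity φ z * g.gradCoord φ u i z)
        (∑ j, (g.volDensity φ y * (g.gram φ y)⁻¹ i j) •
          (fderiv ℝ (fderiv ℝ F) y).flip (EuclideanSpace.single j 1)) y := by
      have : HasFDerivAt
          (fun z => ∑ j, (g.volDensity φ z * (g.gram φ z)⁻¹ i j) * partialD j F z)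
          (∑ j, (g.volDensity φ y * (g.gram φ y)⁻¹ i j) •
          (fderiv ℝ (fderiv ℝ F) y).flip (EuclideanSpace.single j 1)) y :=
        HasFDerivAt.fun_sum fun j _ =>
          (hD j).continuousAt_mul_of_eq_zero (hvol.mul (hinvij i j)) (hD0 j)
      refine this.congr_of_eventuallyEq (.of_forall fun z => ?_)
      simp only [gradCoord, Finset.mul_sum, mul_assoc, F]
    rw [partialD, h1.fderiv]
    simp [Finset.mul_sum, mul_assoc]
  have hv : 0 < g.volDensity φ y := Real.sqrt_pos.mpr hpos.det_pos
  rw [divCoord, Finset.sum_congr rfl fun i _ => key i, ← Finset.mul_sum, ← mul_assoc,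
    inv_mul_cancel₀ hv.ne', one_mul]
  exact hpos.inv.posSemidef.sum_mul_apply_nonpos _ (hmax.fderiv_fderiv_nonpos hu) _

/-- The coordinate field is the tangent map of the inverse chart composed with a constant section of
the model tangent bundle. -/
theorem continuousOn_coordVec (p : M) (i : Fin d) :
    ContinuousOn (fun y => (⟨(chartAt (EuclideanSpace ℝ (Fin d)) p).symm y,
      coordVec (chartAt (EuclideanSpace ℝ (Fin d)) p) i y⟩ : TangentBundle (𝓡 d) M))
      (chartAt (EuclideanSpace ℝ (Fin d)) p).target := by
  set φ := chartAt (EuclideanSpace ℝ (Fin d)) p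
  have h1 : ContMDiffOn (𝓡 d) (𝓡 d) ∞ φ.symm φ.target := contMDiffOn_chart_symm
  have h2 := h1.continuousOn_tangentMapWithin (by simp) φ.open_target.uniqueMDiffOn
  have h3 : Continuous fun y : EuclideanSpace ℝ (Fin d) =>
      (⟨y, (EuclideanSpace.single i 1 : EuclideanSpace ℝ (Fin d))⟩ :
        TangentBundle (𝓡 d) (EuclideanSpace ℝ (Fin d))) :=
    (tangentBundleModelSpaceHomeomorph (𝓡 d)).symm.continuous.comp
      (continuous_id.prodMk continuous_const)
  refine (h2.comp h3.continuousOn fun y hy => hy).congr fun y hy => ?_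
  simp only [Function.comp, tangentMapWithin, coordVec]
  rw [mfderivWithin_of_isOpen φ.open_target hy]

/-- The metric coefficients are continuous in the preferred charts. -/
theorem continuousOn_gram (g : SmoothMetric d M) (p : M) :
    ContinuousOn (g.gram (chartAt (EuclideanSpace ℝ (Fin d)) p))
      (chartAt (EuclideanSpace ℝ (Fin d)) p).target := by
  set φ := chartAt (EuclideanSpace ℝ (Fin d)) p
  refine continuousOn_pi.mpr fun i => continuousOn_pi.mpr fun j => ?_
  have hg : ContinuousOn (fun y => Bundle.TotalSpace.mk'
      (EuclideanSpace ℝ (Fin d) →L[ℝ] EuclideanSpace ℝ (Fin d) →L[ℝ] ℝ)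
      (E := fun x : M => TangentSpace (𝓡 d) x →L[ℝ] TangentSpace (𝓡 d) x →L[ℝ] ℝ)
      (φ.symm y) (g.inner (φ.symm y))) φ.target :=
    g.contMDiff.continuous.comp_continuousOn φ.continuousOn_symm
  have h1 := ContinuousOn.clm_bundle_apply (E₂ := fun x : M => TangentSpace (𝓡 d) x →L[ℝ] ℝ) hg
    (continuousOn_coordVec p i)
  have h2 := ContinuousOn.clm_bundle_apply (E₂ := Bundle.Trivial M ℝ) h1
    (continuousOn_coordVec p j)
  intro y hy
  have := (FiberBundle.continuousWithinAt_totalSpace ℝ _).mp (h2 y hy)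
  exact this.2

/-- The metric matrix is positive definite in the preferred charts. -/
theorem posDef_gram (g : SmoothMetric d M) (p : M) {y : EuclideanSpace ℝ (Fin d)}
    (hy : y ∈ (chartAt (EuclideanSpace ℝ (Fin d)) p).target) :
    (g.gram (chartAt (EuclideanSpace ℝ (Fin d)) p) y).PosDef := by
  set φ := chartAt (EuclideanSpace ℝ (Fin d)) p
  have hinj : Function.Injective (mfderiv (𝓡 d) (𝓡 d) φ.symm y) :=
    ((mdifferentiable_chart (I := 𝓡 d) p).symm).mfderiv_injective hy
  have hlin : ∀ v : Fin d → ℝ, ∑ i, v i • coordVec φ i y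
      = mfderiv (𝓡 d) (𝓡 d) φ.symm y (WithLp.toLp 2 v : EuclideanSpace ℝ (Fin d)) := by
    intro v
    have hv : (WithLp.toLp 2 v : EuclideanSpace ℝ (Fin d))
        = ∑ i, v i • (EuclideanSpace.single i 1 : EuclideanSpace ℝ (Fin d)) := by
      ext k
      simp [Finset.sum_apply, Pi.single_apply]
    rw [hv]
    exact ((map_sum _ _ _).trans (Finset.sum_congr rfl fun i _ => map_smul _ _ _)).symm
  have hquad : ∀ v : Fin d → ℝ, dotProduct v ((g.gram φ y).mulVec v)
      = g.inner (φ.symm y) (∑ i, v i • coordVec φ i y) (∑ i, v i • coordVec φ i y) := by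
    intro v
    simp only [map_sum, map_smul, FunLike.coe_sum, Finset.sum_apply,
      _root_.smul_apply, smul_eq_mul, dotProduct, Matrix.mulVec, gram, Matrix.of_apply,
      Finset.mul_sum]
    rw [Finset.sum_comm]
    exact Finset.sum_congr rfl fun i _ => Finset.sum_congr rfl fun j _ => by ring
  refine Matrix.posDef_iff_dotProduct_mulVec.mpr ⟨?_, fun {v} hv => ?_⟩
  · ext i j
    simp [gram, g.symm]
  · rw [star_trivial, hquad]
    refine g.pos _ _ fun h0 => hv ?_
    rw [hlin] at h0
    have := hinj (h0.trans (map_zero _).symm)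
    exact (WithLp.toLp_eq_zero 2).mp this

/-- The Laplace–Beltrami operator is nonpositive at a maximum. -/
theorem laplaceBeltrami_nonpos (g : SmoothMetric d M) {u : M → ℝ}
    (hu : ContMDiff (𝓡 d) 𝓘(ℝ, ℝ) 2 u) {x : M} (hmax : ∀ z, u z ≤ u x) :
    g.laplaceBeltrami u x ≤ 0 := by
  set φ := chartAt (EuclideanSpace ℝ (Fin d)) x with hφ
  have hx : φ x ∈ φ.target := mem_chart_target _ x
  have hxs : φ.symm (φ x) = x := φ.left_inv (mem_chart_source _ x)
  have hnhds := φ.open_target.mem_nhds hx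
  refine g.divCoord_gradCoord_nonpos φ u (φ x) ?_ ?_ ((g.continuousOn_gram x).continuousAt hnhds)
    (g.posDef_gram x hx)
  · have h1 : ContMDiffOn (𝓡 d) (𝓡 d) 2 φ.symm φ.target :=
      (contMDiffOn_chart_symm (n := ∞)).of_le (WithTop.coe_le_coe.mpr (le_top : (2 : ℕ∞) ≤ ⊤))
    exact (contMDiffOn_iff_contDiffOn.mp (hu.comp_contMDiffOn h1)).contDiffAt hnhds
  · refine Filter.Eventually.of_forall fun z => ?_
    simpa [hxs] using hmax (φ.symm z)

theorem laplaceBeltrami_neg (g : SmoothMetric d M) (u : M → ℝ) (x : M) :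
    g.laplaceBeltrami (fun z => -u z) x = -g.laplaceBeltrami u x := by
  have hp : ∀ (i : Fin d) (F : EuclideanSpace ℝ (Fin d) → ℝ) y,
      partialD i (fun z => -F z) y = -partialD i F y := fun i F y => by
    simp [partialD, fderiv_fun_neg]
  have hgrad : ∀ (φ : OpenPartialHomeomorph M (EuclideanSpace ℝ (Fin d))) i y,
      g.gradCoord φ (fun z => -u z) i y = -g.gradCoord φ u i y := fun φ i y => by
    have : ((fun z => -u z) ∘ φ.symm) = fun z => -(u ∘ φ.symm) z := rfl
    simp only [gradCoord, this, hp, mul_neg, Finset.sum_neg_distrib]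
  simp only [laplaceBeltrami, divCoord, hgrad, mul_neg, hp, Finset.sum_neg_distrib]

theorem continuousOn_volDensity (g : SmoothMetric d M) (p : M) :
    ContinuousOn (g.volDensity (chartAt (EuclideanSpace ℝ (Fin d)) p))
      (chartAt (EuclideanSpace ℝ (Fin d)) p).target :=
  Real.continuous_sqrt.comp_continuousOn
    ((Continuous.matrix_det continuous_id).comp_continuousOn (g.continuousOn_gram p))

theorem volDensity_pos (g : SmoothMetric d M) (p : M) {y : EuclideanSpace ℝ (Fin d)}
    (hy : y ∈ (chartAt (EuclideanSpace ℝ (Fin d)) p).target) :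
    0 < g.volDensity (chartAt (EuclideanSpace ℝ (Fin d)) p) y :=
  Real.sqrt_pos.mpr (g.posDef_gram p hy).det_pos

/-! ### Finiteness and nonvanishing of the Riemannian volume -/

section Volume

variable [MeasurableSpace M] [BorelSpace M]

theorem chartVolume_apply (g : SmoothMetric d M) (p : M) {s : Set M} (hs : MeasurableSet s) :
    g.chartVolume (chartAt (EuclideanSpace ℝ (Fin d)) p) s =
      ∫⁻ y in (chartAt (EuclideanSpace ℝ (Fin d)) p).target ∩
        (chartAt (EuclideanSpace ℝ (Fin d)) p).symm ⁻¹' s,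
        ENNReal.ofReal (g.volDensity (chartAt (EuclideanSpace ℝ (Fin d)) p) y) := by
  set φ := chartAt (EuclideanSpace ℝ (Fin d)) p
  have hφ : AEMeasurable φ.symm (volume.restrict φ.target) :=
    φ.continuousOn_symm.aemeasurable φ.open_target.measurableSet
  rw [chartVolume, Measure.map_apply_of_aemeasurable
    (hφ.mono_ac (withDensity_absolutelyContinuous _ _)) hs, withDensity_apply',
    Measure.restrict_restrict' φ.open_target.measurableSet, inter_comm]

theorem chartVolume_lt_top_of_isCompact [T2Space M] (g : SmoothMetric d M) (p : M) {K : Set M}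
    (hK : IsCompact K) (hKs : K ⊆ (chartAt (EuclideanSpace ℝ (Fin d)) p).source) :
    g.chartVolume (chartAt (EuclideanSpace ℝ (Fin d)) p) K < ⊤ := by
  set φ := chartAt (EuclideanSpace ℝ (Fin d)) p
  rw [g.chartVolume_apply p hK.measurableSet, ← φ.image_eq_target_inter_inv_preimage hKs]
  have hc : IsCompact (φ '' K) := hK.image_of_continuousOn (φ.continuousOn.mono hKs)
  have hsub : φ '' K ⊆ φ.target := image_subset_iff.mpr fun x hx => φ.map_source (hKs hx)
  exact (((g.continuousOn_volDensity p).mono hsub).integrableOn_compact hc).lintegral_lt_top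

theorem chartVolume_pos_of_isOpen (g : SmoothMetric d M) (p : M) {U : Set M} (hU : IsOpen U)
    {x : M} (hxU : x ∈ U) (hx : x ∈ (chartAt (EuclideanSpace ℝ (Fin d)) p).source) :
    0 < g.chartVolume (chartAt (EuclideanSpace ℝ (Fin d)) p) U := by
  set φ := chartAt (EuclideanSpace ℝ (Fin d)) p with hφ
  rw [g.chartVolume_apply p hU.measurableSet]
  have hopen : IsOpen (φ.target ∩ φ.symm ⁻¹' U) :=
    φ.continuousOn_symm.isOpen_inter_preimage φ.open_target hU
  have hvol : 0 < volume (φ.target ∩ φ.symm ⁻¹' U) :=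
    hopen.measure_pos _ ⟨φ x, φ.map_source hx, by simpa [φ.left_inv hx] using hxU⟩
  have hmeas : AEMeasurable (fun y => ENNReal.ofReal (g.volDensity φ y))
      (volume.restrict (φ.target ∩ φ.symm ⁻¹' U)) :=
    (((g.continuousOn_volDensity p).mono inter_subset_left).aemeasurable
      hopen.measurableSet).ennreal_ofReal
  refine pos_iff_ne_zero.mpr fun h0 => hvol.ne' ?_
  rw [lintegral_eq_zero_iff' hmeas, Filter.EventuallyEq,
    ae_restrict_iff' hopen.measurableSet] at h0
  -- The density is positive throughout the open set, so that set lies in the exceptional null set.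
  rw [← nonpos_iff_eq_zero, ← ae_iff.mp h0]
  refine measure_mono fun y hy => ?_
  simpa [hy.1, hy.2] using
    (⟨hy.2, g.volDensity_pos p hy.1⟩ : φ.symm y ∈ U ∧ 0 < g.volDensity φ y)

theorem partitionVolume_univ_pos [Nonempty M] (g : SmoothMetric d M)
    (ρ : SmoothPartitionOfUnity M (𝓡 d) M)
    (hρ : ρ.IsSubordinate fun p => (chartAt (EuclideanSpace ℝ (Fin d)) p).source) :
    0 < g.partitionVolume ρ univ := by
  obtain ⟨x⟩ := ‹Nonempty M›
  obtain ⟨p, hp⟩ := ρ.exists_pos_of_mem (mem_univ x)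
  rw [partitionVolume, Measure.sum_apply _ MeasurableSet.univ]
  refine lt_of_lt_of_le ?_ (ENNReal.le_tsum p)
  rw [withDensity_apply _ MeasurableSet.univ, Measure.restrict_univ]
  have hcont : Continuous (ρ p) := (ρ p).contMDiff.continuous
  have hsupp : Function.support (fun x => ENNReal.ofReal (ρ p x)) = {x | 0 < ρ p x} := by
    ext z
    simp
  rw [lintegral_pos_iff_support hcont.measurable.ennreal_ofReal, hsupp]
  exact g.chartVolume_pos_of_isOpen p (isOpen_lt continuous_const hcont) hp
    (hρ p (subset_tsupport _ hp.ne'))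

variable [T2Space M] [CompactSpace M]

/-- By compactness only finitely many `ρ p` are nonzero, and each is at most the indicator of its
support, a compact subset of a chart domain. -/
theorem partitionVolume_univ_lt_top (g : SmoothMetric d M)
    (ρ : SmoothPartitionOfUnity M (𝓡 d) M)
    (hρ : ρ.IsSubordinate fun p => (chartAt (EuclideanSpace ℝ (Fin d)) p).source) :
    g.partitionVolume ρ univ < ⊤ := by
  have hfin : {p | (Function.support (ρ p)).Nonempty}.Finite :=
    ρ.locallyFinite.finite_nonempty_of_compact
  rw [partitionVolume, Measure.sum_apply _ MeasurableSet.univ,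
    tsum_eq_sum (s := hfin.toFinset)]
  · refine ENNReal.sum_lt_top.mpr fun p _ => ?_
    rw [withDensity_apply _ MeasurableSet.univ, Measure.restrict_univ]
    have hK : IsCompact (tsupport (ρ p)) := (isClosed_tsupport _).isCompact
    refine lt_of_le_of_lt ?_ (g.chartVolume_lt_top_of_isCompact p hK (hρ p))
    rw [← lintegral_indicator_one hK.measurableSet]
    refine lintegral_mono fun x => ?_
    by_cases hx : x ∈ tsupport (ρ p)
    · simpa [hx] using ρ.le_one p x
    · simp [image_eq_zero_of_notMem_tsupport hx]
  · intro p hp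
    have h0 : ∀ x, ρ p x = 0 := by
      simpa [Set.Nonempty] using hp
    simp [h0]

instance isFiniteMeasure_riemannianVolume (g : SmoothMetric d M) :
    IsFiniteMeasure g.riemannianVolume :=
  ⟨g.partitionVolume_univ_lt_top _
    (SmoothPartitionOfUnity.exists_isSubordinate_chartAt_source (𝓡 d) M).choose_spec⟩

instance neZero_riemannianVolume [Nonempty M] (g : SmoothMetric d M) :
    NeZero g.riemannianVolume :=
  ⟨fun h => (g.partitionVolume_univ_pos _
    (SmoothPartitionOfUnity.exists_isSubordinate_chartAt_source (𝓡 d) M).choose_spec).ne'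
    (Measure.measure_univ_eq_zero.mpr h)⟩

end Volume

/-! ### Maximum principle and conclusion -/

/-- Maximum principle: an upper bound for `-Δ u + υ u` bounds `u` from above. -/
theorem le_div_of_helmholtz_le [CompactSpace M] (g : SmoothMetric d M) {υ B : ℝ} (hυ : 0 < υ)
    {u : M → ℝ} (hu : ContMDiff (𝓡 d) 𝓘(ℝ, ℝ) 2 u)
    (h : ∀ x, -g.laplaceBeltrami u x + υ * u x ≤ B) (x : M) : u x ≤ B / υ := by
  have : Nonempty M := ⟨x⟩
  obtain ⟨z, -, hz⟩ := isCompact_univ.exists_isMaxOn univ_nonempty hu.continuous.continuousOn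
  have hmax : ∀ y, u y ≤ u z := fun y => hz (mem_univ y)
  refine (hmax x).trans ((le_div_iff₀ hυ).mpr ?_)
  linarith [h z, g.laplaceBeltrami_nonpos hu hmax, mul_comm υ (u z)]

theorem div_le_of_le_helmholtz [CompactSpace M] (g : SmoothMetric d M) {υ B : ℝ} (hυ : 0 < υ)
    {u : M → ℝ} (hu : ContMDiff (𝓡 d) 𝓘(ℝ, ℝ) 2 u)
    (h : ∀ x, B ≤ -g.laplaceBeltrami u x + υ * u x) (x : M) : B / υ ≤ u x := by
  have := g.le_div_of_helmholtz_le (B := -B) (u := fun z => -u z) hυ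
    (contDiff_neg.contMDiff.comp hu)
    (fun z => by rw [laplaceBeltrami_neg]; linarith [h z]) x
  rw [neg_div] at this
  linarith

end SmoothMetric

theorem theorem2 {d : ℕ} {M : Type*} [TopologicalSpace M]
    [ChartedSpace (EuclideanSpace ℝ (Fin d)) M] [IsManifold (𝓡 d) ∞ M]
    [T2Space M] [CompactSpace M] [MeasurableSpace M] [BorelSpace M]
    (g : SmoothMetric d M) (υ : ℝ) (hυ : 0 < υ)
    (f : M → ℝ) (hf : Continuous f)
    (fmin fmax : ℝ) (hmin : IsLeast (Set.range f) fmin) (hmax : IsGreatest (Set.range f) fmax)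
    (c : ℝ) (hc : c = ⨍ x, f x ∂g.riemannianVolume)
    (σ : M → ℝ) (hσ : ContMDiff (𝓡 d) 𝓘(ℝ, ℝ) 2 σ)
    (hsol : ∀ x, -g.laplaceBeltrami σ x + υ * σ x = c - f x) :
    (∀ x, (c - fmax) / υ ≤ σ x ∧ σ x ≤ (c - fmin) / υ) ∧
    (∀ x, Real.exp (2 / υ * (c - fmax)) ≤ conformalFactor σ x ∧
      conformalFactor σ x ≤ Real.exp (2 / υ * (c - fmin))) ∧
    ((∀ x y, f x = f y) →
      (∀ x, σ x = 0 ∧ conformalFactor σ x = 1) ∧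
      (∀ x, (c - fmax) / υ = σ x ∧ σ x = (c - fmin) / υ) ∧
      (∀ x, Real.exp (2 / υ * (c - fmax)) = conformalFactor σ x ∧
        conformalFactor σ x = Real.exp (2 / υ * (c - fmin)))) := by
  have hbound : ∀ x, (c - fmax) / υ ≤ σ x ∧ σ x ≤ (c - fmin) / υ := fun x =>
    ⟨g.div_le_of_le_helmholtz hυ hσ
      (fun z => by rw [hsol]; linarith [hmax.2 (Set.mem_range_self z)]) x,
    g.le_div_of_helmholtz_le hυ hσ
      (fun z => by rw [hsol]; linarith [hmin.2 (Set.mem_range_self z)]) x⟩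
  have hexp : ∀ t : ℝ, 2 / υ * t = 2 * (t / υ) := fun t => by ring
  refine ⟨hbound, fun x => ?_, fun hconst => ?_⟩
  · simp only [conformalFactor, hexp, Real.exp_le_exp]
    exact ⟨by linarith [(hbound x).1], by linarith [(hbound x).2]⟩
  · obtain ⟨a, ha⟩ := hmin.1
    obtain ⟨b, hb⟩ := hmax.1
    have : Nonempty M := ⟨a⟩
    have hca : c = f a := by
      -- `average_const` needs a finite nonzero measure, supplied by the two volume instances.
      rw [hc, show f = fun _ => f a from funext fun x => hconst x a, average_const]
    have hcmin : c - fmin = 0 := by rw [← ha, hca, sub_self]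
    have hcmax : c - fmax = 0 := by rw [← hb, hca, hconst b a, sub_self]
    have hzero : ∀ x, σ x = 0 := fun x => by
      have := hbound x
      rw [hcmin, hcmax, zero_div] at this
      exact le_antisymm this.2 this.1
    simp [hzero, conformalFactor, hcmin, hcmax]
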